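/- Let $q$ be a prime power and $\mathbb F_q$ a finite field of order $q$. The spectrum of $A\in\mathbb F_q^{n\times n}$ is $\sigma(A)=\{\lambda\in\mathbb F_q : \lambda \text{ is an eigenvalue of } A\}$. Let $$s_n(q)=|\{A\in\mathbb F_q^{n\times n} : \sigma(A)=\emptyset\}|,\qquad \gamma_n(q)=|\mathrm{GL}_n(\mathbb F_q)|=\prod_{j=0}^{n-1}(q^n-q^j),$$ and let $a_0(q)=1$ and $a_j(q)=(-1)^j\prod_{\ell=1}^{j}\frac{1}{q^\ell-1}$ for $j\ge 1$. Then $$1+\sum_{n=1}^\infty \frac{s_n(q)}{\gamma_n(q)}u^n=\frac{1}{1-u}\prod_{r\ge 1}\Bigl(1-\frac{u}{q^r}\Bigr)^{q-1},$$ both as an identity of formal power series in $u$ over $\mathbb R$ (the product converging coefficientwise) and as an identity of convergent series and products for all complex $u$ with $|u|<1$. Moreover, for every $n\ge 0$, $$s_n(q)=\gamma_n(q)\sum_{j=0}^n\ \sum_{\substack{i_1,\ldots,i_{q-1}\in\mathbb N_0\\ i_1+\cdots+i_{q-1}=j}}a_{i_1}(q)\cdots a_{i_{q-1}}(q).$$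 Furthermore, $$\lim_{n\to\infty}\frac{s_n(q)}{q^{n^2}}=\prod_{r\ge1}\Bigl(1-\frac1{q^r}\Bigr)^q=\lim_{n\to\infty}\Bigl(\frac{\gamma_n(q)}{q^{n^2}}\Bigr)^q$$ for every prime power $q$, and for every fixed $n\ge 0$, as $q$ tends to infinity through the prime powers, $$\lim_{q\to\infty}\frac{s_n(q)}{q^{n^2}}=\sum_{j=0}^n\frac{(-1)^j}{j!}.$$ -/

import Mathlib

universe u

open Filter Topology
open scoped PowerSeries.WithPiTopology

namespace SpecFree

/-- The spectrum `σ(A)`: the set of eigenvalues of `A` in the base field `F`. -/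
def eigenvalueSet {F : Type*} [Field F] {n : ℕ} (A : Matrix (Fin n) (Fin n) F) : Set F :=
  {c : F | Module.End.HasEigenvalue (Matrix.toLin' A) c}

/-- `s_n(q)`: the number of `n × n` matrices over `F` (a field of order `q`) with empty spectrum. -/
noncomputable def s (F : Type*) [Field F] (n : ℕ) : ℕ :=
  Nat.card {A : Matrix (Fin n) (Fin n) F // eigenvalueSet A = ∅}

/-- `γ_n(q)`: the order of the general linear group `GL_n(F)`. -/
noncomputable def γ (F : Type*) [Field F] (n : ℕ) : ℕ :=
  Nat.card (Matrix.GeneralLinearGroup (Fin n) F)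

/-- `a_j(q) = (-1)^j ∏_{ℓ=1}^j 1/(q^ℓ - 1)`; in particular `a_0(q) = 1`. -/
noncomputable def a (q j : ℕ) : ℝ :=
  (-1) ^ j * ∏ l ∈ Finset.Icc 1 j, 1 / ((q : ℝ) ^ l - 1)

end SpecFree

/-! By Fitting's decomposition, an endomorphism of `F^n` is, uniquely, a nilpotent map on one
summand and an invertible map on a complement. For `S` a set of scalars let `A_S(u)` be the series
of counts of endomorphisms with no eigenvalue in `S`, divided by `γ_n`, and let `N(u)` be the same
series for nilpotents. The decomposition, after a translation moving `c` to `0`, gives `A_S = N *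
A_{S ∪ {c}}` for `c ∉ S` (`card_avoiding_mul`, `avoidSeries_eq_mul`). Adding all `q` scalars one at
a time gives `A_∅ = N^q * A_univ`, while adding only `0` gives `A_∅ = N/(1-u)`, since avoiding `0`
means being invertible. Hence `A_univ = N^{-(q-1)}/(1-u)`.

To invert `N`: `A_∅` has coefficients `q^(n²)/γ_n`, so `(1-u) A_∅(u) = A_∅(u/q)`, that is `N(u) =
A_∅(u/q)`. The series `G = ∑ a_j u^j` satisfies `G(u) = (1-u/q) G(u/q)`, so `N * G` is invariant
under `u ↦ u/q` and equals `1` (`nilpotentSeries_mul_aSeries`). Iterating the equation for `G` gives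
its infinite product, formally and at every point, because `G` is entire.

Now `s_n/γ_n` is a partial sum of the coefficients of `G^(q-1)`, so it tends to `G(1)^(q-1)`, while
`γ_n/q^(n²)` tends to `G(1)`. For `q → ∞`, a recursion from the logarithmic derivative shows that
the coefficients of `G^(q-1)` tend to those of `exp(-u)`. -/

namespace SpecFree

/-! ### Fitting decomposition: existence and uniqueness -/

section Fitting

variable {F : Type*} [Field F] {V M N : Type*} [AddCommGroup V] [Module F V]
  [AddCommGroup M] [Module F M] [AddCommGroup N] [Module F N]

theorem not_hasEigenvalue_iff {f : Module.End F V} {c : F} :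
    ¬ f.HasEigenvalue c ↔ ∀ v, f v = c • v → v = 0 := by
  rw [Module.End.hasEigenvalue_iff, not_not, Submodule.eq_bot_iff]
  simp

theorem not_hasEigenvalue_zero_iff {f : Module.End F V} :
    ¬ f.HasEigenvalue 0 ↔ Function.Injective f := by
  rw [not_hasEigenvalue_iff, injective_iff_map_eq_zero]
  simp

theorem pow_intertwine {f : Module.End F V} {g : Module.End F M} {h : M → V}
    (H : ∀ x, f (h x) = h (g x)) (k : ℕ) (x : M) : (f ^ k) (h x) = h ((g ^ k) x) := by
  induction k generalizing x with
  | zero => simp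
  | succ k ih => rw [pow_succ, pow_succ, Module.End.mul_apply, Module.End.mul_apply, H, ih]

theorem prodMap_pow_apply (B : Module.End F M) (C : Module.End F N) (k : ℕ) (x : M × N) :
    ((LinearMap.prodMap B C : Module.End F (M × N)) ^ k) x = ((B ^ k) x.1, (C ^ k) x.2) := by
  induction k generalizing x with
  | zero => simp
  | succ k ih => simp [pow_succ, ih]

theorem IsNilpotent.not_hasEigenvalue {B : Module.End F M} (hB : IsNilpotent B) {c : F}
    (hc : c ≠ 0) : ¬ B.HasEigenvalue c := by
  rw [not_hasEigenvalue_iff]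
  intro v hv
  obtain ⟨k, hk⟩ := hB
  have h : ∀ j, (B ^ j) v = c ^ j • v := by
    intro j
    induction j with
    | zero => simp
    | succ j ih => rw [pow_succ, Module.End.mul_apply, hv, map_smul, ih, smul_smul, pow_succ']
  have := h k
  rw [hk, LinearMap.zero_apply] at this
  simpa [hc] using this.symm

/-- The endomorphism `e ∘ (B × C) ∘ e⁻¹`. -/
def glue (e : (M × N) ≃ₗ[F] V) (B : Module.End F M) (C : Module.End F N) : Module.End F V :=
  e.conj (LinearMap.prodMap B C)

theorem glue_apply (e : (M × N) ≃ₗ[F] V) (B : Module.End F M) (C : Module.End F N) (x : M × N) :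
    glue e B C (e x) = e (B x.1, C x.2) := by
  simp [glue, LinearEquiv.conj_apply]

theorem glue_eq_iff {e : (M × N) ≃ₗ[F] V} {B : Module.End F M} {C : Module.End F N}
    {f : Module.End F V} : glue e B C = f ↔ ∀ x : M × N, f (e x) = e (B x.1, C x.2) := by
  constructor
  · rintro rfl x
    exact glue_apply e B C x
  · intro h
    ext v
    obtain ⟨x, rfl⟩ := e.surjective v
    rw [glue_apply, h]

theorem glue_pow_apply (e : (M × N) ≃ₗ[F] V) (B : Module.End F M) (C : Module.End F N) (k : ℕ)
    (x : M × N) : (glue e B C ^ k) (e x) = e ((B ^ k) x.1, (C ^ k) x.2) := by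
  rw [← prodMap_pow_apply]
  exact pow_intertwine (g := LinearMap.prodMap B C) (fun y => glue_apply e B C y) k x

theorem not_hasEigenvalue_glue_iff (e : (M × N) ≃ₗ[F] V) (B : Module.End F M)
    (C : Module.End F N) (c : F) :
    ¬ (glue e B C).HasEigenvalue c ↔ ¬ B.HasEigenvalue c ∧ ¬ C.HasEigenvalue c := by
  simp only [not_hasEigenvalue_iff]
  constructor
  · intro h
    constructor
    · intro v hv
      have := h (e (v, 0)) (by rw [glue_apply, ← map_smul]; simp [hv])
      simpa using this
    · intro v hv
      have := h (e (0, v)) (by rw [glue_apply, ← map_smul]; simp [hv])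
      simpa using this
  · rintro ⟨h1, h2⟩ v hv
    obtain ⟨⟨x, y⟩, rfl⟩ := e.surjective v
    rw [glue_apply, ← map_smul, e.injective.eq_iff, Prod.ext_iff] at hv
    rw [h1 x hv.1, h2 y hv.2]
    exact map_zero e

theorem pow_injective {C : Module.End F N} (hC : Function.Injective C) (k : ℕ) :
    Function.Injective ⇑(C ^ k) := by
  rw [Module.End.coe_pow]; exact hC.iterate k

/-- The generalized kernel is exactly the image of `M`: powers of `B` eventually vanish, powers of
`C` stay injective. So the dimension of the nilpotent part can be read off from the glued map. -/
theorem finrank_maxGenEigenspace_glue (e : (M × N) ≃ₗ[F] V) {B : Module.End F M}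
    {C : Module.End F N} (hB : IsNilpotent B) (hC : Function.Injective C) :
    Module.finrank F ((glue e B C).maxGenEigenspace 0) = Module.finrank F M := by
  have : (glue e B C).maxGenEigenspace 0 =
      LinearMap.range (e.toLinearMap ∘ₗ LinearMap.inl F M N) := by
    ext v
    obtain ⟨⟨x, y⟩, rfl⟩ := e.surjective v
    simp only [Module.End.mem_maxGenEigenspace, zero_smul, sub_zero, glue_pow_apply]
    constructor
    · rintro ⟨k, hk⟩
      have hy : y = 0 := by
        have := (Prod.ext_iff.1 (e.injective (hk.trans (map_zero e).symm))).2
        exact pow_injective hC k (by simpa using this)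
      exact ⟨x, by simp [hy]⟩
    · rintro ⟨m, hm⟩
      obtain ⟨k, hk⟩ := hB
      refine ⟨k, ?_⟩
      have := e.injective hm
      simp only [LinearMap.inl_apply, Prod.ext_iff] at this
      simp [← this.2, hk]
  rw [this, LinearMap.finrank_range_of_inj]
  exact e.injective.comp LinearMap.inl_injective

theorem glue_prodCongr_trans (e : (M × N) ≃ₗ[F] V) (B : Module.End F M) (C : Module.End F N)
    (p : M ≃ₗ[F] M) (s : N ≃ₗ[F] N) :
    glue ((p.prodCongr s).trans e) (p.symm.conj B) (s.symm.conj C) = glue e B C := by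
  rw [glue_eq_iff]
  rintro ⟨x, y⟩
  simp [glue_apply, LinearEquiv.conj_apply]

variable [FiniteDimensional F M] [FiniteDimensional F N]

/-- Uniqueness in Fitting's decomposition: the transition map between two decompositions intertwines
the block maps, and this forces it to be block diagonal. -/
theorem exists_prodCongr_of_glue_eq {e e' : (M × N) ≃ₗ[F] V} {B B' : Module.End F M}
    {C C' : Module.End F N} (hB : IsNilpotent B) (hB' : IsNilpotent B')
    (hC : Function.Injective C) (hC' : Function.Injective C')
    (h : glue e B C = glue e' B' C') :
    ∃ (p : M ≃ₗ[F] M) (s : N ≃ₗ[F] N), e' = (p.prodCongr s).trans e ∧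
      B' = p.symm.conj B ∧ C' = s.symm.conj C := by
  set t : (M × N) ≃ₗ[F] (M × N) := e'.trans e.symm with ht
  have hH : ∀ x, LinearMap.prodMap B C (t x) = t (LinearMap.prodMap B' C' x) := by
    intro x
    apply e.injective
    have h1 := glue_apply e B C (t x)
    rw [h] at h1
    have h2 := glue_apply e' B' C' x
    have h3 : e (t x) = e' x := by simp [ht]
    rw [h3, h2] at h1
    rw [LinearMap.prodMap_apply, ← h1]
    simp [ht]
  have hpow := fun k x => pow_intertwine (f := LinearMap.prodMap B C)
    (g := LinearMap.prodMap B' C') (h := t) hH k x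
  simp only [prodMap_pow_apply] at hpow
  -- A power killing `(m, 0)` also kills its image, whose `N`-component must vanish because `C ^ k`
  -- is injective.
  have hl : ∀ m, (t (m, 0)).2 = 0 := by
    intro m
    obtain ⟨k, hk⟩ := hB'
    have := congrArg Prod.snd (hpow k (m, 0))
    simp only [hk, LinearMap.zero_apply, map_zero, Prod.mk_zero_zero, Prod.snd_zero] at this
    exact pow_injective hC k (by simpa using this)
  -- `C' ^ k` is onto by finite dimension, so `y` is a `k`-th image, and `B ^ k = 0` kills the
  -- `M`-component.
  have hr : ∀ y, (t (0, y)).1 = 0 := by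
    intro y
    obtain ⟨k, hk⟩ := hB
    obtain ⟨z, rfl⟩ := LinearMap.surjective_of_injective (pow_injective hC' k) y
    have := congrArg Prod.fst (hpow k (0, z))
    simpa [hk] using this.symm
  have hp : Function.Injective (LinearMap.fst F M N ∘ₗ t.toLinearMap ∘ₗ LinearMap.inl F M N) := by
    rw [injective_iff_map_eq_zero]
    intro m hm
    have : t (m, 0) = 0 := Prod.ext hm (hl m)
    simpa using this
  have hs : Function.Injective (LinearMap.snd F M N ∘ₗ t.toLinearMap ∘ₗ LinearMap.inr F M N) := by
    rw [injective_iff_map_eq_zero]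
    intro m hm
    have : t (0, m) = 0 := Prod.ext (hr m) hm
    simpa using this
  let p := LinearEquiv.ofInjectiveEndo _ hp
  let s := LinearEquiv.ofInjectiveEndo _ hs
  have hpa : ∀ m, p m = (t (m, 0)).1 := fun m => rfl
  have hsa : ∀ m, s m = (t (0, m)).2 := fun m => rfl
  have hta : ∀ x, t x = (p x.1, s x.2) := by
    intro x
    have : x = (x.1, 0) + (0, x.2) := by simp
    rw [this, map_add]
    ext <;> simp [hpa, hsa, hl, hr]
  refine ⟨p, s, ?_, ?_, ?_⟩
  · ext x : 1
    have : e' x = e (t x) := by simp [ht]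
    rw [this, hta]; rfl
  · ext m
    have := hH (m, 0)
    simp only [hta, LinearMap.prodMap_apply, Prod.ext_iff] at this
    simp [LinearEquiv.conj_apply, this.1]
  · ext m
    have := hH (0, m)
    simp only [hta, LinearMap.prodMap_apply, Prod.ext_iff] at this
    simp [LinearEquiv.conj_apply, this.2]

variable [FiniteDimensional F V]

theorem exists_glue_eq (f : Module.End F V)
    (hM : Module.finrank F (f.maxGenEigenspace 0) = Module.finrank F M)
    (hV : Module.finrank F V = Module.finrank F M + Module.finrank F N) :
    ∃ (e : (M × N) ≃ₗ[F] V) (B : Module.End F M) (C : Module.End F N),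
      IsNilpotent B ∧ Function.Injective C ∧ glue e B C = f := by
  obtain ⟨k, hk⟩ := eventually_atTop.mp f.eventually_isCompl_ker_pow_range_pow
  -- The exponent exceeds both the Fitting threshold `k` and the dimension, beyond which kernels of
  -- powers no longer grow.
  set K := LinearMap.ker (f ^ (k + Module.finrank F V)) with hKdef
  set R := LinearMap.range (f ^ (k + Module.finrank F V)) with hRdef
  have hKR : IsCompl K R := hk _ (by omega)
  have hK : f.maxGenEigenspace 0 = K := by
    ext v
    simp only [Module.End.mem_maxGenEigenspace, zero_smul, sub_zero]
    constructor
    · rintro ⟨j, hj⟩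
      have h1 : v ∈ LinearMap.ker (f ^ j) := hj
      have h2 := Module.End.ker_pow_le_ker_pow_finrank f j h1
      rw [hKdef, LinearMap.mem_ker, pow_add, Module.End.mul_apply, LinearMap.mem_ker.1 h2, map_zero]
    · intro hv
      exact ⟨_, hv⟩
  have hfK : ∀ v ∈ K, f v ∈ K := by
    intro v hv
    rw [hKdef, LinearMap.mem_ker] at hv ⊢
    rw [← Module.End.mul_apply, ← pow_succ, pow_succ', Module.End.mul_apply, hv, map_zero]
  have hfR : ∀ v ∈ R, f v ∈ R := by
    rintro _ ⟨w, rfl⟩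
    exact ⟨f w, by rw [← Module.End.mul_apply, ← pow_succ, pow_succ', Module.End.mul_apply]⟩
  rw [hK] at hM
  have hR : Module.finrank F R = Module.finrank F N := by
    have := Submodule.finrank_add_eq_of_isCompl hKR
    omega
  let eM : M ≃ₗ[F] K := LinearEquiv.ofFinrankEq _ _ hM.symm
  let eN : N ≃ₗ[F] R := LinearEquiv.ofFinrankEq _ _ hR.symm
  refine ⟨(eM.prodCongr eN).trans (Submodule.prodEquivOfIsCompl K R hKR),
    eM.symm.conj (f.restrict hfK), eN.symm.conj (f.restrict hfR), ?_, ?_, ?_⟩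
  · refine ⟨k + Module.finrank F V, ?_⟩
    ext x
    have := pow_intertwine (f := f.restrict hfK) (g := eM.symm.conj (f.restrict hfK)) (h := eM)
      (fun x => by simp [LinearEquiv.conj_apply]) (k + Module.finrank F V) x
    rw [LinearMap.zero_apply, ← map_eq_zero_iff eM eM.injective, ← this]
    ext
    have h2 := pow_intertwine (f := f) (g := f.restrict hfK) (h := K.subtype)
      (fun x => by simp) (k + Module.finrank F V) (eM x)
    simp only [Submodule.subtype_apply] at h2
    rw [← h2]
    exact (eM x).2
  · rw [injective_iff_map_eq_zero]
    intro x hx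
    have h1 : f (eN x) = 0 := by
      have := congrArg eN hx
      simpa [LinearEquiv.conj_apply, Subtype.ext_iff] using this
    have h2 : (eN x : V) ∈ K := by
      rw [← hK, Module.End.mem_maxGenEigenspace]
      exact ⟨1, by simpa using h1⟩
    have h3 : (eN x : V) = 0 := by
      have := hKR.disjoint.le_bot (Submodule.mem_inf.2 ⟨h2, (eN x).2⟩)
      simpa using this
    simpa using h3
  · rw [glue_eq_iff]
    rintro ⟨x, y⟩
    simp [LinearEquiv.conj_apply]

end Fitting

/-! ### Counting over a finite field -/

section Counting

variable (F : Type*) [Field F]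

/-- The number of endomorphisms of `F^n` without eigenvalues in `S`. -/
noncomputable def numAvoiding (S : Set F) (n : ℕ) : ℕ :=
  Nat.card {f : Module.End F (Fin n → F) // ∀ c ∈ S, ¬ f.HasEigenvalue c}

/-- The number of nilpotent endomorphisms of `F^n`. -/
noncomputable def numNilpotent (n : ℕ) : ℕ :=
  Nat.card {f : Module.End F (Fin n → F) // IsNilpotent f}

theorem card_linearEquiv (n : ℕ) : Nat.card ((Fin n → F) ≃ₗ[F] (Fin n → F)) = γ F n :=
  Nat.card_congr ((LinearMap.GeneralLinearGroup.generalLinearEquiv F (Fin n → F)).symm.trans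
    Matrix.GeneralLinearGroup.toLin.symm).toEquiv

theorem card_linearEquiv_prod {k l n : ℕ} (h : k + l = n) :
    Nat.card (((Fin k → F) × (Fin l → F)) ≃ₗ[F] (Fin n → F)) = γ F n := by
  rw [← card_linearEquiv]
  let e : ((Fin k → F) × (Fin l → F)) ≃ₗ[F] (Fin n → F) :=
    LinearEquiv.ofFinrankEq _ _ (by simp [h])
  exact Nat.card_congr
    ⟨fun g => e.symm.trans g, fun g => e.trans g, fun g => by ext : 1; simp, fun g => by ext : 1; simp⟩

theorem s_eq_numAvoiding (n : ℕ) : s F n = numAvoiding F Set.univ n := by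
  refine Nat.card_congr (Matrix.toLin'.toEquiv.subtypeEquiv fun A => ?_)
  simp [eigenvalueSet, Set.eq_empty_iff_forall_notMem]

theorem numAvoiding_image_add (S : Set F) (c : F) (n : ℕ) :
    numAvoiding F ((· + c) '' S) n = numAvoiding F S n := by
  symm
  refine Nat.card_congr ((Equiv.addRight (c • (1 : Module.End F (Fin n → F)))).subtypeEquiv
    fun f => ?_)
  simp only [Set.forall_mem_image]
  refine forall₂_congr fun d _ => ?_
  simp [not_hasEigenvalue_iff, add_smul]

theorem numAvoiding_zero_eq (n : ℕ) : numAvoiding F {0} n = γ F n := by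
  rw [← card_linearEquiv]
  symm
  refine Nat.card_congr (Equiv.ofBijective
    (fun e => ⟨e.toLinearMap, by simpa [not_hasEigenvalue_zero_iff] using e.injective⟩) ⟨?_, ?_⟩)
  · intro e e' h
    exact LinearEquiv.toLinearMap_injective (Subtype.ext_iff.1 h)
  · rintro ⟨f, hf⟩
    refine ⟨LinearEquiv.ofInjectiveEndo f (not_hasEigenvalue_zero_iff.1 (hf 0 rfl)), ?_⟩
    ext1
    rfl

theorem numAvoiding_empty (n : ℕ) : numAvoiding F ∅ n = Nat.card F ^ n ^ 2 := by
  have : numAvoiding F ∅ n = Nat.card (Matrix (Fin n) (Fin n) F) := by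
    refine Nat.card_congr ((Equiv.subtypeUnivEquiv (by simp)).trans LinearMap.toMatrix'.toEquiv)
  rw [this]
  simp [Matrix, Nat.card_fun, ← pow_mul, sq]

variable {F}

/-- Triples consisting of a decomposition of `F^n`, a nilpotent endomorphism of the first summand,
and an endomorphism of the second one without eigenvalues in `S`. -/
abbrev GlueData (F : Type*) [Field F] (S : Set F) (k l n : ℕ) : Type _ :=
  (((Fin k → F) × (Fin l → F)) ≃ₗ[F] (Fin n → F)) ×
    {B : Module.End F (Fin k → F) // IsNilpotent B} ×
    {C : Module.End F (Fin l → F) // ∀ c ∈ S, ¬ C.HasEigenvalue c}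

/-- The fibre is a torsor under `GL_k × GL_l`, acting by change of basis in the two summands.
Transitivity is the uniqueness of the decomposition; freeness holds because `e` determines both
factors. -/
theorem card_fiber_glue {S : Set F} {k l n : ℕ} (h : k + l = n)
    {f : Module.End F (Fin n → F)} (hf : ∀ c ∈ S, ¬ f.HasEigenvalue c)
    (hk : Module.finrank F (f.maxGenEigenspace 0) = k) :
    Nat.card {x : GlueData F (insert 0 S) k l n // glue x.1 x.2.1.1 x.2.2.1 = f} =
      γ F k * γ F l := by
  have hinj : ∀ C : {C : Module.End F (Fin l → F) // ∀ c ∈ insert 0 S, ¬ C.HasEigenvalue c},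
      Function.Injective C.1 := fun C =>
    not_hasEigenvalue_zero_iff.1 (C.2 0 (Set.mem_insert _ _))
  obtain ⟨e, B, C, hB, hC, rfl⟩ := exists_glue_eq (M := Fin k → F) (N := Fin l → F) f
    (by simpa using hk) (by simp [h])
  rw [← card_linearEquiv, ← card_linearEquiv, ← Nat.card_prod]
  symm
  have hmem : ∀ (p : (Fin k → F) ≃ₗ[F] (Fin k → F)) (s : (Fin l → F) ≃ₗ[F] (Fin l → F)),
      IsNilpotent (p.symm.conj B) ∧
        ∀ c ∈ insert 0 S, ¬ Module.End.HasEigenvalue (s.symm.conj C) c := by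
    intro p s
    constructor
    · obtain ⟨j, hj⟩ := hB
      refine ⟨j, ?_⟩
      refine LinearMap.ext fun x => ?_
      have := pow_intertwine (f := B) (g := p.symm.conj B) (h := p)
        (fun x => by simp [LinearEquiv.conj_apply]) j x
      rw [LinearMap.zero_apply, ← map_eq_zero_iff p p.injective, ← this, hj, LinearMap.zero_apply]
    · intro c hc
      have hCc : ¬ C.HasEigenvalue c := by
        rcases hc with rfl | hc
        · exact not_hasEigenvalue_zero_iff.2 hC
        · exact ((not_hasEigenvalue_glue_iff e B C c).1 (hf c hc)).2
      rw [not_hasEigenvalue_iff] at hCc ⊢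
      intro v hv
      have := hCc (s v) (by rw [← map_smul, ← hv]; simp [LinearEquiv.conj_apply])
      simpa using this
  refine Nat.card_congr (Equiv.ofBijective
    (fun ps => ⟨((ps.1.prodCongr ps.2).trans e, ⟨ps.1.symm.conj B, (hmem ps.1 ps.2).1⟩,
      ⟨ps.2.symm.conj C, (hmem ps.1 ps.2).2⟩), glue_prodCongr_trans e B C ps.1 ps.2⟩) ⟨?_, ?_⟩)
  · rintro ⟨p, s⟩ ⟨p', s'⟩ hps
    have h1 : (p.prodCongr s).trans e = (p'.prodCongr s').trans e :=
      congrArg (fun x => x.1.1) hps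
    have h2 : ∀ x : (Fin k → F) × (Fin l → F), (p x.1, s x.2) = (p' x.1, s' x.2) := fun x =>
      e.injective (LinearEquiv.congr_fun h1 x)
    refine Prod.ext (LinearEquiv.ext fun x => ?_) (LinearEquiv.ext fun x => ?_)
    · exact congrArg Prod.fst (h2 (x, 0))
    · exact congrArg Prod.snd (h2 (0, x))
  · rintro ⟨⟨e', B', C'⟩, hx⟩
    obtain ⟨p, s, h1, h2, h3⟩ :=
      exists_prodCongr_of_glue_eq hB B'.2 hC (hinj C') hx.symm
    exact ⟨(p, s), Subtype.ext (Prod.ext h1.symm (Prod.ext (Subtype.ext h2.symm)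
      (Subtype.ext h3.symm)))⟩

variable (F) [Finite F]

theorem γ_pos (n : ℕ) : 0 < γ F n := Nat.card_pos

instance (n m : ℕ) : Finite ((Fin n → F) →ₗ[F] (Fin m → F)) :=
  Finite.of_injective _ DFunLike.coe_injective

instance (k l n : ℕ) : Finite (((Fin k → F) × (Fin l → F)) ≃ₗ[F] (Fin n → F)) :=
  Finite.of_injective _ DFunLike.coe_injective

variable {F}

/-- Double count of the gluing data: every fibre has the same size. The nilpotent block avoids `S`
automatically as `0 ∉ S`, and inserting `0` makes the other block invertible. -/
theorem card_avoiding_mul {S : Set F} (h0 : (0 : F) ∉ S) {k l n : ℕ} (h : k + l = n) :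
    Nat.card {f : {f : Module.End F (Fin n → F) // ∀ c ∈ S, ¬ f.HasEigenvalue c} //
      Module.finrank F (f.1.maxGenEigenspace 0) = k} * (γ F k * γ F l) =
      γ F n * (numNilpotent F k * numAvoiding F (insert 0 S) l) := by
  have hinj : ∀ C : {C : Module.End F (Fin l → F) // ∀ c ∈ insert 0 S, ¬ C.HasEigenvalue c},
      Function.Injective C.1 := fun C =>
    not_hasEigenvalue_zero_iff.1 (C.2 0 (Set.mem_insert _ _))
  rw [numNilpotent, numAvoiding, ← Nat.card_prod, ← card_linearEquiv_prod F h, ← Nat.card_prod]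
  symm
  have hmem : ∀ x : GlueData F (insert 0 S) k l n,
      ∀ c ∈ S, ¬ (glue x.1 x.2.1.1 x.2.2.1).HasEigenvalue c := by
    intro x c hc
    rw [not_hasEigenvalue_glue_iff]
    exact ⟨IsNilpotent.not_hasEigenvalue x.2.1.2 (fun h => h0 (h ▸ hc)),
      x.2.2.2 c (Set.mem_insert_of_mem _ hc)⟩
  let Φ : GlueData F (insert 0 S) k l n →
      {f : {f : Module.End F (Fin n → F) // ∀ c ∈ S, ¬ f.HasEigenvalue c} //
        Module.finrank F (f.1.maxGenEigenspace 0) = k} := fun x =>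
    ⟨⟨glue x.1 x.2.1.1 x.2.2.1, hmem x⟩, by
      simpa using finrank_maxGenEigenspace_glue x.1 x.2.1.2 (hinj x.2.2)⟩
  rw [Nat.card_congr (Equiv.sigmaFiberEquiv Φ).symm]
  have := Fintype.ofFinite {f : {f : Module.End F (Fin n → F) // ∀ c ∈ S, ¬ f.HasEigenvalue c} //
        Module.finrank F (f.1.maxGenEigenspace 0) = k}
  rw [Nat.card_sigma, Finset.sum_congr rfl (fun f _ => ?_), Finset.sum_const, smul_eq_mul,
    Finset.card_univ, ← Nat.card_eq_fintype_card]
  rw [← card_fiber_glue h f.1.2 f.2]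
  refine Nat.card_congr (Equiv.subtypeEquivRight fun x => ?_)
  simp [Φ, Subtype.ext_iff]

theorem numAvoiding_div_eq {S : Set F} (h0 : (0 : F) ∉ S) (n : ℕ) :
    (numAvoiding F S n : ℝ) / γ F n = ∑ p ∈ Finset.HasAntidiagonal.antidiagonal n,
      (numNilpotent F p.1 : ℝ) / γ F p.1 * ((numAvoiding F (insert 0 S) p.2 : ℝ) / γ F p.2) := by
  have hsum : numAvoiding F S n = ∑ p ∈ Finset.HasAntidiagonal.antidiagonal n,
      Nat.card {f : {f : Module.End F (Fin n → F) // ∀ c ∈ S, ¬ f.HasEigenvalue c} //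
        Module.finrank F (f.1.maxGenEigenspace 0) = p.1} := by
    have := Fintype.ofFinite {f : Module.End F (Fin n → F) // ∀ c ∈ S, ¬ f.HasEigenvalue c}
    rw [numAvoiding, Finset.Nat.sum_antidiagonal_eq_sum_range_succ_mk, Nat.card_eq_fintype_card,
      ← Finset.card_univ, Finset.card_eq_sum_card_fiberwise
        (f := fun f => Module.finrank F (f.1.maxGenEigenspace 0)) (t := Finset.range n.succ)]
    · refine Finset.sum_congr rfl fun k _ => ?_
      rw [Nat.card_eq_fintype_card, Fintype.card_subtype]
    · intro f _
      have := Submodule.finrank_le (f.1.maxGenEigenspace 0)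
      simp at this
      simpa [Nat.lt_succ_iff] using this
  rw [hsum, Nat.cast_sum, Finset.sum_div]
  refine Finset.sum_congr rfl fun p hp => ?_
  have := card_avoiding_mul h0 (Finset.HasAntidiagonal.mem_antidiagonal.1 hp)
  have h1 : (γ F n : ℝ) ≠ 0 := by exact_mod_cast (γ_pos F n).ne'
  have h2 : (γ F p.1 : ℝ) ≠ 0 := by exact_mod_cast (γ_pos F p.1).ne'
  have h3 : (γ F p.2 : ℝ) ≠ 0 := by exact_mod_cast (γ_pos F p.2).ne'
  rw [div_mul_div_comm, div_eq_div_iff h1 (mul_ne_zero h2 h3)]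
  rw [mul_comm _ (γ F n : ℝ)]
  exact_mod_cast this

/-- The generating function of `numAvoiding F S n / γ F n`. -/
noncomputable def avoidSeries (S : Set F) : PowerSeries ℝ :=
  PowerSeries.mk fun n => (numAvoiding F S n : ℝ) / γ F n

variable (F) in
/-- The generating function of `numNilpotent F n / γ F n`. -/
noncomputable def nilpotentSeries : PowerSeries ℝ :=
  PowerSeries.mk fun n => (numNilpotent F n : ℝ) / γ F n

theorem avoidSeries_eq_mul {S : Set F} {c : F} (hc : c ∉ S) :
    avoidSeries S = nilpotentSeries F * avoidSeries (insert c S) := by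
  ext n
  have h0 : (0 : F) ∉ (· + -c) '' S := by
    rintro ⟨d, hd, h⟩
    rw [add_neg_eq_zero] at h
    exact hc (h ▸ hd)
  have := numAvoiding_div_eq h0 n
  -- Writing the inserted `0` as `c + -c` exhibits both sets as translates by `-c`.
  rw [← add_neg_cancel c, ← Set.image_insert_eq (f := (· + -c))] at this
  simpa only [numAvoiding_image_add, avoidSeries, nilpotentSeries, PowerSeries.coeff_mul,
    PowerSeries.coeff_mk] using this

theorem avoidSeries_empty_eq (S : Finset F) :
    avoidSeries (∅ : Set F) = nilpotentSeries F ^ S.card * avoidSeries (S : Set F) := by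
  classical
  induction S using Finset.induction_on with
  | empty => simp
  | insert c S hc ih =>
    rw [ih, avoidSeries_eq_mul (S := (S : Set F)) (c := c) (by simpa using hc),
      Finset.card_insert_of_notMem hc, Finset.coe_insert, pow_succ, mul_assoc]

theorem avoidSeries_zero : avoidSeries ({0} : Set F) = PowerSeries.mk 1 := by
  ext n
  have h1 : (γ F n : ℝ) ≠ 0 := by exact_mod_cast (γ_pos F n).ne'
  simp [avoidSeries, numAvoiding_zero_eq, h1]

end Counting

/-! ### The functional equation and formal products -/

section Formal

open PowerSeries (C X coeff rescale mk constantCoeff)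

theorem eq_one_of_rescale_eq {x : ℝ} (hx0 : 0 ≤ x) (hx1 : x < 1) {H : PowerSeries ℝ}
    (h0 : constantCoeff H = 1) (h : rescale x H = H) : H = 1 := by
  ext n
  rcases Nat.eq_zero_or_pos n with rfl | hn
  · simpa using h0
  · have := congrArg (coeff n) h
    rw [PowerSeries.coeff_rescale] at this
    have h1 : x ^ n < 1 := pow_lt_one₀ hx0 hx1 hn.ne'
    have h2 : (1 - x ^ n) * coeff n H = 0 := by rw [sub_mul, this]; ring
    rw [PowerSeries.coeff_one, if_neg hn.ne']
    exact (mul_eq_zero.1 h2).resolve_left (by linarith)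

theorem prod_mul_rescale_eq {x : ℝ} {G : PowerSeries ℝ} (hG : G = (1 - C x * X) * rescale x G)
    (m : ℕ) :
    (∏ r ∈ Finset.range m, (1 - C (x ^ (r + 1)) * X)) * rescale (x ^ m) G = G := by
  induction m with
  | zero => simp
  | succ m ih =>
    conv_rhs => rw [← ih, hG]
    rw [Finset.prod_range_succ, map_mul, PowerSeries.rescale_rescale, mul_assoc]
    congr 2
    · simp only [map_sub, map_one, map_mul, PowerSeries.rescale_X]
      congr 1
      rw [show rescale (x ^ m) (C x) = C x by
        ext n; rw [PowerSeries.coeff_rescale, PowerSeries.coeff_C]; split_ifs with h <;> simp [h],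
        ← mul_assoc, ← map_mul, pow_succ']
    · rw [pow_succ']

/-- After expansion over finite sets `s` of factors, each coefficient is bounded by `∏ i ∈ s, x ^ (i
+ 1)`, which is summable over `s`. -/
theorem multipliable_one_sub {x : ℝ} (hx0 : 0 ≤ x) (hx1 : x < 1) :
    Multipliable (fun r : ℕ => (1 - C (x ^ (r + 1)) * X : PowerSeries ℝ)) := by
  simp only [sub_eq_add_neg]
  apply multipliable_one_add_of_summable_prod
  rw [PowerSeries.WithPiTopology.summable_iff_summable_coeff]
  intro d
  have hs : Summable (fun r : ℕ => x ^ (r + 1)) :=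
    (summable_nat_add_iff 1).2 (summable_geometric_of_lt_one hx0 hx1)
  refine (summable_finsetProd_of_summable_nonneg (f := fun r : ℕ => x ^ (r + 1))
    (fun r => by positivity) hs).of_norm_bounded (fun s => ?_)
  have : ∏ i ∈ s, -(C (x ^ (i + 1)) * X) =
      C (∏ i ∈ s, -x ^ (i + 1)) * (X : PowerSeries ℝ) ^ s.card := by
    rw [map_prod, ← Finset.prod_const, ← Finset.prod_mul_distrib]
    simp
  rw [this, PowerSeries.coeff_C_mul, PowerSeries.coeff_X_pow, Real.norm_eq_abs, abs_mul,
    Finset.abs_prod]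
  have hp : ∏ i ∈ s, |-x ^ (i + 1)| = ∏ i ∈ s, x ^ (i + 1) :=
    Finset.prod_congr rfl fun i _ => by rw [abs_neg, abs_of_nonneg (by positivity)]
  rw [hp]
  have : 0 ≤ ∏ i ∈ s, x ^ (i + 1) := Finset.prod_nonneg fun i _ => by positivity
  split_ifs <;> simp [this]

/-- Iterating the functional equation leaves the remainder `G(x^m u)`, which tends coefficientwise
to the constant term `1`. -/
theorem hasProd_one_sub {x : ℝ} (hx0 : 0 ≤ x) (hx1 : x < 1) {G : PowerSeries ℝ}
    (h0 : constantCoeff G = 1) (hG : G = (1 - C x * X) * rescale x G) :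
    HasProd (fun r : ℕ => (1 - C (x ^ (r + 1)) * X : PowerSeries ℝ)) G := by
  have hm := (multipliable_one_sub hx0 hx1).hasProd
  have h1 : Tendsto (fun m : ℕ => rescale (x ^ m) G) atTop (𝓝 1) := by
    rw [PowerSeries.WithPiTopology.tendsto_iff_coeff_tendsto]
    intro d
    simp only [PowerSeries.coeff_rescale, ← pow_mul, PowerSeries.coeff_one]
    split_ifs with hd
    · subst hd; simp [h0]
    · simp only [mul_comm _ d, pow_mul]
      simpa using (tendsto_pow_atTop_nhds_zero_of_lt_one (by positivity)
        (pow_lt_one₀ hx0 hx1 hd)).mul_const (coeff d G)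
  have h2 := hm.tendsto_prod_nat.mul h1
  simp only [prod_mul_rescale_eq hG, mul_one] at h2
  rwa [tendsto_nhds_unique tendsto_const_nhds h2]

/-- The power series `∑ a_j(q) u^j`. -/
noncomputable def aSeries (q : ℕ) : PowerSeries ℝ := mk (a q)

theorem a_zero (q : ℕ) : a q 0 = 1 := by simp [a]

theorem a_succ (q j : ℕ) : a q (j + 1) = -a q j / ((q : ℝ) ^ (j + 1) - 1) := by
  rw [a, a, Finset.prod_Icc_succ_top (by omega), pow_succ]
  ring

theorem aSeries_eq {q : ℕ} (hq : 2 ≤ q) :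
    aSeries q = (1 - C (1 / (q : ℝ)) * X) * rescale (1 / (q : ℝ)) (aSeries q) := by
  have hq' : (2 : ℝ) ≤ q := by exact_mod_cast hq
  ext n
  rw [sub_mul, one_mul, map_sub, mul_assoc, PowerSeries.coeff_C_mul]
  cases n with
  | zero => simp [aSeries]
  | succ n =>
    simp only [aSeries, PowerSeries.coeff_mk, PowerSeries.coeff_succ_X_mul,
      PowerSeries.coeff_rescale, a_succ]
    have h1 : (1 : ℝ) < (q : ℝ) ^ (n + 1) := one_lt_pow₀ (by linarith) (by omega)
    have h2 : (q : ℝ) ^ (n + 1) - 1 ≠ 0 := by linarith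
    have h3 : (q : ℝ) ≠ 0 := by linarith
    rw [one_div_pow, one_div_pow]
    field_simp
    ring

theorem one_div_mem {q : ℕ} (hq : 2 ≤ q) : 0 ≤ 1 / (q : ℝ) ∧ 1 / (q : ℝ) < 1 := by
  have hq' : (2 : ℝ) ≤ q := by exact_mod_cast hq
  refine ⟨by positivity, ?_⟩
  rw [div_lt_one (by linarith)]
  linarith

theorem hasProd_aSeries {q : ℕ} (hq : 2 ≤ q) :
    HasProd (fun r : ℕ => (1 - C (1 / (q : ℝ) ^ (r + 1)) * X : PowerSeries ℝ)) (aSeries q) := by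
  simpa only [one_div_pow] using hasProd_one_sub (one_div_mem hq).1 (one_div_mem hq).2
    (by simp [aSeries, a_zero]) (aSeries_eq hq)

theorem mk_one_mul_one_sub_X : (mk 1 : PowerSeries ℝ) * (1 - X) = 1 :=
  PowerSeries.mk_one_mul_one_sub_eq_one ℝ

/-! ### Identifying the generating functions -/

variable (F : Type*) [Field F] [Fintype F]

theorem γ_eq_prod (n : ℕ) :
    (γ F n : ℝ) = ∏ j ∈ Finset.range n, ((Fintype.card F : ℝ) ^ n - (Fintype.card F : ℝ) ^ j) := by
  rw [γ, Matrix.card_GL_field, Nat.cast_prod, ← Fin.prod_univ_eq_prod_range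
    (fun j => (Fintype.card F : ℝ) ^ n - (Fintype.card F : ℝ) ^ j)]
  refine Finset.prod_congr rfl fun i _ => ?_
  rw [Nat.cast_sub (Nat.pow_le_pow_right Fintype.card_pos i.2.le)]
  simp

theorem γ_div_eq_prod (n : ℕ) : (γ F n : ℝ) / (Fintype.card F : ℝ) ^ (n ^ 2) =
    ∏ j ∈ Finset.range n, (1 - 1 / (Fintype.card F : ℝ) ^ (j + 1)) := by
  have hq : (Fintype.card F : ℝ) ≠ 0 := by exact_mod_cast Fintype.card_ne_zero
  rw [γ_eq_prod, sq, pow_mul, ← Finset.prod_range_reflect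
    (fun j => 1 - 1 / (Fintype.card F : ℝ) ^ (j + 1))]
  have hpow : ((Fintype.card F : ℝ) ^ n) ^ n =
      ∏ _j ∈ Finset.range n, (Fintype.card F : ℝ) ^ n := by simp
  rw [hpow, ← Finset.prod_div_distrib]
  refine Finset.prod_congr rfl fun j hj => ?_
  have hj' := Finset.mem_range.1 hj
  rw [show n - 1 - j + 1 = n - j by omega, sub_div, div_self (pow_ne_zero _ hq)]
  congr 1
  rw [div_eq_div_iff (pow_ne_zero _ hq) (pow_ne_zero _ hq), one_mul, ← pow_add,
    Nat.add_sub_cancel' hj'.le]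

theorem avoidSeries_empty_mul :
    avoidSeries (∅ : Set F) * (1 - X) =
      rescale (1 / (Fintype.card F : ℝ)) (avoidSeries (∅ : Set F)) := by
  have hq : (Fintype.card F : ℝ) ≠ 0 := by exact_mod_cast Fintype.card_ne_zero
  have hc : ∀ n, coeff n (avoidSeries (∅ : Set F)) =
      (∏ j ∈ Finset.range n, (1 - 1 / (Fintype.card F : ℝ) ^ (j + 1)))⁻¹ := by
    intro n
    rw [← γ_div_eq_prod, avoidSeries, PowerSeries.coeff_mk, numAvoiding_empty, inv_div,
      Nat.card_eq_fintype_card, Nat.cast_pow]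
  ext n
  rw [mul_sub, mul_one, map_sub, PowerSeries.coeff_rescale]
  cases n with
  | zero => simp
  | succ n =>
    rw [PowerSeries.coeff_succ_mul_X, hc, hc, Finset.prod_range_succ, mul_inv, ← one_div_pow]
    have : (1 : ℝ) - (1 / (Fintype.card F : ℝ)) ^ (n + 1) ≠ 0 := by
      have hx := one_div_mem (q := Fintype.card F) Fintype.one_lt_card
      have := pow_lt_one₀ hx.1 hx.2 (Nat.succ_ne_zero n)
      simp only [Nat.succ_eq_add_one] at this
      linarith
    set P := (∏ j ∈ Finset.range n, (1 - 1 / (Fintype.card F : ℝ) ^ (j + 1)))⁻¹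
    linear_combination P * (mul_inv_cancel₀ this)

theorem nilpotentSeries_eq :
    nilpotentSeries F = rescale (1 / (Fintype.card F : ℝ)) (avoidSeries (∅ : Set F)) := by
  rw [← avoidSeries_empty_mul, avoidSeries_eq_mul (Set.notMem_empty (0 : F)), insert_empty_eq,
    avoidSeries_zero, mul_assoc, mk_one_mul_one_sub_X, mul_one]

/-- The two functional equations carry the factor `1 - u/q` on opposite sides, so it cancels in the
product, which is then fixed by `u ↦ u/q`. -/
theorem nilpotentSeries_mul_aSeries : nilpotentSeries F * aSeries (Fintype.card F) = 1 := by
  have hq : 2 ≤ Fintype.card F := Fintype.one_lt_card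
  refine eq_one_of_rescale_eq (one_div_mem hq).1 (one_div_mem hq).2 ?_ ?_
  · have h0 : (γ F 0 : ℝ) ≠ 0 := by exact_mod_cast (γ_pos F 0).ne'
    rw [nilpotentSeries_eq, map_mul, ← PowerSeries.coeff_zero_eq_constantCoeff_apply,
      ← PowerSeries.coeff_zero_eq_constantCoeff_apply]
    simp [avoidSeries, numAvoiding_empty, aSeries, a_zero, γ_eq_prod]
  · conv_rhs => rw [aSeries_eq hq]
    nth_rw 2 [nilpotentSeries_eq]
    rw [map_mul, nilpotentSeries_eq, ← avoidSeries_empty_mul, map_mul, map_sub, map_one,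
      PowerSeries.rescale_X, avoidSeries_empty_mul, mul_assoc]

theorem avoidSeries_univ_eq :
    avoidSeries (Set.univ : Set F) = mk 1 * aSeries (Fintype.card F) ^ (Fintype.card F - 1) := by
  have h1 := avoidSeries_empty_eq (Finset.univ : Finset F)
  rw [avoidSeries_eq_mul (Set.notMem_empty (0 : F)), insert_empty_eq, avoidSeries_zero,
    Finset.card_univ, Finset.coe_univ] at h1
  have h2 := nilpotentSeries_mul_aSeries F
  obtain ⟨m, hm⟩ : ∃ m, Fintype.card F = m + 1 := ⟨Fintype.card F - 1, by
    have := Fintype.card_pos (α := F); omega⟩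
  have h3 : (nilpotentSeries F * aSeries (Fintype.card F)) ^ Fintype.card F = 1 := by
    rw [h2, one_pow]
  calc avoidSeries (Set.univ : Set F)
      = (nilpotentSeries F * aSeries (Fintype.card F)) ^ Fintype.card F *
        avoidSeries (Set.univ : Set F) := by rw [h3, one_mul]
    _ = aSeries (Fintype.card F) ^ Fintype.card F *
        (nilpotentSeries F ^ Fintype.card F * avoidSeries (Set.univ : Set F)) := by ring
    _ = _ := by
      rw [← h1, show Fintype.card F - 1 = m by omega]
      nth_rw 2 [hm]
      rw [pow_succ]
      linear_combination (mk 1 * aSeries (Fintype.card F) ^ m) * h2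

theorem s_div_γ_eq_coeff (n : ℕ) : (s F n : ℝ) / γ F n =
    coeff n (mk 1 * aSeries (Fintype.card F) ^ (Fintype.card F - 1)) := by
  rw [← avoidSeries_univ_eq, avoidSeries, PowerSeries.coeff_mk, s_eq_numAvoiding]

theorem coeff_mk_one_mul (P : PowerSeries ℝ) (n : ℕ) :
    coeff n (mk 1 * P) = ∑ j ∈ Finset.range (n + 1), coeff j P := by
  rw [mul_comm, PowerSeries.coeff_mul, Finset.Nat.sum_antidiagonal_eq_sum_range_succ_mk]
  simp

theorem coeff_pow_eq_sum_antidiagonalTuple (f : ℕ → ℝ) (k j : ℕ) :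
    coeff j (mk f ^ k) = ∑ i ∈ Finset.Nat.antidiagonalTuple k j, ∏ l : Fin k, f (i l) := by
  have h : (mk f : PowerSeries ℝ) ^ k = ∏ _l : Fin k, mk f := by simp
  rw [h, PowerSeries.coeff_prod]
  refine Finset.sum_equiv Finsupp.equivFunOnFinite (fun i => ?_) (fun i _ => by simp)
  simp [Finset.mem_finsuppAntidiag, Finset.Nat.mem_antidiagonalTuple]

theorem s_eq_mul_sum (n : ℕ) : (s F n : ℝ) = (γ F n : ℝ) *
    ∑ j ∈ Finset.range (n + 1), ∑ i ∈ Finset.Nat.antidiagonalTuple (Fintype.card F - 1) j,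
      ∏ k : Fin (Fintype.card F - 1), a (Fintype.card F) (i k) := by
  have h0 : (γ F n : ℝ) ≠ 0 := by exact_mod_cast (γ_pos F n).ne'
  rw [mul_comm, ← div_eq_iff h0, s_div_γ_eq_coeff, coeff_mk_one_mul]
  exact Finset.sum_congr rfl fun j _ => coeff_pow_eq_sum_antidiagonalTuple _ _ _

end Formal

/-! ### Convergence at points and the limit in `n` -/

section Evaluation

open PowerSeries (C X coeff rescale mk constantCoeff)

variable {𝕜 : Type*} [RCLike 𝕜]

/-- The real power series `p` converges absolutely at `z` with value `v`. -/
def EvalsTo (p : PowerSeries ℝ) (z v : 𝕜) : Prop :=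
  Summable (fun n => ‖((coeff n p : ℝ) : 𝕜) * z ^ n‖) ∧ ∑' n, ((coeff n p : ℝ) : 𝕜) * z ^ n = v

theorem EvalsTo.mul {p p' : PowerSeries ℝ} {z v v' : 𝕜} (h : EvalsTo p z v)
    (h' : EvalsTo p' z v') : EvalsTo (p * p') z (v * v') := by
  have key : ∀ n, ((coeff n (p * p') : ℝ) : 𝕜) * z ^ n =
      ∑ kl ∈ Finset.HasAntidiagonal.antidiagonal n,
        (((coeff kl.1 p : ℝ) : 𝕜) * z ^ kl.1) * (((coeff kl.2 p' : ℝ) : 𝕜) * z ^ kl.2) := by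
    intro n
    rw [PowerSeries.coeff_mul, RCLike.ofReal_sum, Finset.sum_mul]
    refine Finset.sum_congr rfl fun kl hkl => ?_
    rw [← Finset.HasAntidiagonal.mem_antidiagonal.1 hkl, pow_add, RCLike.ofReal_mul]
    ring
  constructor
  · simp only [key]
    exact summable_norm_sum_mul_antidiagonal_of_summable_norm
      (f := fun n => ((coeff n p : ℝ) : 𝕜) * z ^ n) (g := fun n => ((coeff n p' : ℝ) : 𝕜) * z ^ n)
      h.1 h'.1
  · simp only [key]
    rw [← tsum_mul_tsum_eq_tsum_sum_antidiagonal_of_summable_norm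
      (f := fun n => ((coeff n p : ℝ) : 𝕜) * z ^ n) (g := fun n => ((coeff n p' : ℝ) : 𝕜) * z ^ n)
      h.1 h'.1, h.2, h'.2]

theorem EvalsTo.of_eq_zero {p : PowerSeries ℝ} (z : 𝕜) (N : ℕ) (hp : ∀ n, N ≤ n → coeff n p = 0) :
    EvalsTo p z (∑ n ∈ Finset.range N, ((coeff n p : ℝ) : 𝕜) * z ^ n) := by
  have h0 : ∀ n ∉ Finset.range N, ((coeff n p : ℝ) : 𝕜) * z ^ n = 0 := by
    intro n hn
    rw [hp n (by simpa using hn)]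
    simp
  exact ⟨summable_of_ne_finset_zero (s := Finset.range N) fun n hn => by simp [h0 n hn],
    tsum_eq_sum h0⟩

theorem EvalsTo.pow {p : PowerSeries ℝ} {z v : 𝕜} (h : EvalsTo p z v) (k : ℕ) :
    EvalsTo (p ^ k) z (v ^ k) := by
  induction k with
  | zero =>
    simpa using EvalsTo.of_eq_zero (p := 1) z 1 fun n hn => by
      rw [PowerSeries.coeff_one, if_neg (by omega)]
  | succ k ih => simpa only [pow_succ] using ih.mul h

theorem evalsTo_mk_one {z : 𝕜} (hz : ‖z‖ < 1) : EvalsTo (mk 1) z (1 / (1 - z)) := by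
  constructor
  · simpa using summable_geometric_of_lt_one (norm_nonneg z) hz
  · simpa using tsum_geometric_of_norm_lt_one hz

/-- Ratio test: consecutive terms have ratio of norm `‖z‖ / (q^(n+1) - 1)`, which tends to `0` for
every `z`. -/
theorem summable_aSeries {q : ℕ} (hq : 2 ≤ q) (z : 𝕜) :
    Summable (fun n => ‖((coeff n (aSeries q) : ℝ) : 𝕜) * z ^ n‖) := by
  have hq' : (2 : ℝ) ≤ q := by exact_mod_cast hq
  have ht : Tendsto (fun n : ℕ => ‖z‖ / ((q : ℝ) ^ (n + 1) - 1)) atTop (𝓝 0) := by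
    refine Tendsto.div_atTop tendsto_const_nhds (tendsto_atTop_add_const_right _ _ ?_)
    exact (tendsto_pow_atTop_atTop_of_one_lt (by linarith)).comp (tendsto_add_atTop_nat 1)
  refine summable_of_ratio_norm_eventually_le (r := 1 / 2) (by norm_num) ?_
  filter_upwards [ht.eventually_le_const (show (0 : ℝ) < 1 / 2 by norm_num)] with n hn
  have h1 : (1 : ℝ) < (q : ℝ) ^ (n + 1) := one_lt_pow₀ (by linarith) (by omega)
  simp only [aSeries, PowerSeries.coeff_mk, a_succ, norm_mul, norm_pow,
    RCLike.norm_ofReal, abs_div, abs_neg, Real.norm_eq_abs, abs_abs, abs_norm]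
  rw [abs_of_pos (sub_pos.2 h1)]
  calc |a q n| / ((q : ℝ) ^ (n + 1) - 1) * ‖z‖ ^ (n + 1)
      = ‖z‖ / ((q : ℝ) ^ (n + 1) - 1) * (|a q n| * ‖z‖ ^ n) := by ring
    _ ≤ _ := by gcongr

/-- The sum of the series `∑ a_j(q) z^j`. -/
noncomputable def aSum (q : ℕ) (z : 𝕜) : 𝕜 := ∑' n, ((coeff n (aSeries q) : ℝ) : 𝕜) * z ^ n

theorem evalsTo_aSeries {q : ℕ} (hq : 2 ≤ q) (z : 𝕜) : EvalsTo (aSeries q) z (aSum q z) :=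
  ⟨summable_aSeries hq z, rfl⟩

theorem aSum_eq {q : ℕ} (hq : 2 ≤ q) (z : 𝕜) :
    aSum q z = (1 - z / q) * aSum q (z / q) := by
  have h1 : EvalsTo (1 - C (1 / (q : ℝ)) * X) z (1 - z / q) := by
    have := EvalsTo.of_eq_zero (p := 1 - C (1 / (q : ℝ)) * X) z 2 fun n hn => by
      obtain ⟨m, rfl⟩ := Nat.exists_eq_add_of_le' hn
      rw [map_sub, PowerSeries.coeff_one, PowerSeries.coeff_C_mul, PowerSeries.coeff_X,
        if_neg (by omega), if_neg (by omega)]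
      simp
    convert this using 1
    simp [Finset.sum_range_succ, PowerSeries.coeff_X, PowerSeries.coeff_one]
    ring
  have h2 : EvalsTo (rescale (1 / (q : ℝ)) (aSeries q)) z (aSum q (z / q)) := by
    have key : ∀ n, ((coeff n (rescale (1 / (q : ℝ)) (aSeries q)) : ℝ) : 𝕜) * z ^ n =
        ((coeff n (aSeries q) : ℝ) : 𝕜) * (z / q) ^ n := by
      intro n
      rw [PowerSeries.coeff_rescale]
      push_cast
      rw [div_pow, div_pow, one_pow]
      ring
    refine ⟨?_, ?_⟩
    · simp only [key]
      exact summable_aSeries hq _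
    · simp only [key]
      rfl
  have h3 := (h1.mul h2).2
  rw [← aSeries_eq hq] at h3
  exact h3

theorem prod_mul_aSum_eq {q : ℕ} (hq : 2 ≤ q) (z : 𝕜) (m : ℕ) :
    (∏ r ∈ Finset.range m, (1 - z / (q : 𝕜) ^ (r + 1))) * aSum q (z / (q : 𝕜) ^ m) =
      aSum q z := by
  induction m with
  | zero => simp
  | succ m ih =>
    rw [Finset.prod_range_succ, mul_assoc, ← ih, aSum_eq hq (z / (q : 𝕜) ^ m), div_div, ← pow_succ]

/-- Dominated convergence, with the terms of the series at `z` itself as the bound. -/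
theorem tendsto_aSum {q : ℕ} (hq : 2 ≤ q) (z : 𝕜) :
    Tendsto (fun m : ℕ => aSum q (z / (q : 𝕜) ^ m)) atTop (𝓝 1) := by
  have hq' : (2 : ℝ) ≤ q := by exact_mod_cast hq
  have h0 : (1 : 𝕜) = ∑' n, if n = 0 then (1 : 𝕜) else 0 := by simp
  rw [h0]
  refine tendsto_tsum_of_dominated_convergence (summable_aSeries hq z) ?_ ?_
  · intro n
    split_ifs with hn
    · subst hn
      simp [aSeries, a_zero]
    · have h1 : Tendsto (fun m : ℕ => z / (q : 𝕜) ^ m) atTop (𝓝 0) := by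
        have h2 : Tendsto (fun m : ℕ => (1 / (q : 𝕜)) ^ m) atTop (𝓝 0) := by
          apply tendsto_pow_atTop_nhds_zero_of_norm_lt_one
          rw [norm_div, norm_one, RCLike.norm_natCast, div_lt_one (by linarith)]
          linarith
        simpa [div_eq_mul_inv] using h2.const_mul z
      simpa [hn] using (h1.pow n).const_mul ((coeff n (aSeries q) : ℝ) : 𝕜)
  · refine Eventually.of_forall fun m n => ?_
    rw [norm_mul, norm_mul]
    gcongr
    rw [norm_pow, norm_pow, norm_div, norm_pow, RCLike.norm_natCast]
    gcongr
    exact div_le_self (norm_nonneg _) (one_le_pow₀ (by linarith))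

theorem hasProd_aSum {q : ℕ} (hq : 2 ≤ q) (z : 𝕜) :
    HasProd (fun r : ℕ => 1 - z / (q : 𝕜) ^ (r + 1)) (aSum q z) := by
  have hx := one_div_mem hq
  have hm : Multipliable (fun r : ℕ => 1 - z / (q : 𝕜) ^ (r + 1)) := by
    simp only [sub_eq_add_neg]
    apply multipliable_one_add_of_summable
    have := ((summable_nat_add_iff 1).2 (summable_geometric_of_lt_one hx.1 hx.2)).mul_left ‖z‖
    refine this.congr fun r => ?_
    rw [norm_neg, norm_div, norm_pow, RCLike.norm_natCast, one_div_pow]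
    ring
  have h2 := hm.hasProd.tendsto_prod_nat.mul (tendsto_aSum hq z)
  simp only [prod_mul_aSum_eq hq, mul_one] at h2
  rw [tendsto_nhds_unique tendsto_const_nhds h2]
  exact hm.hasProd

theorem hasProd_pow {α ι : Type*} [CommMonoid α] [TopologicalSpace α] [ContinuousMul α]
    {f : ι → α} {v : α} (h : HasProd f v) (k : ℕ) : HasProd (fun i => f i ^ k) (v ^ k) := by
  simpa only [HasProd, Finset.prod_pow] using Tendsto.pow h k

variable (F : Type*) [Field F] [Fintype F]

/-- The factor `1/(1-u)` turns coefficients into partial sums, and these converge to the value at `u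
= 1`. -/
theorem tendsto_s_div_γ : Tendsto (fun n : ℕ => (s F n : ℝ) / γ F n) atTop
    (𝓝 (aSum (Fintype.card F) (1 : ℝ) ^ (Fintype.card F - 1))) := by
  have h := (evalsTo_aSeries (Fintype.one_lt_card (α := F)) (1 : ℝ)).pow (Fintype.card F - 1)
  have h2 := h.1.of_norm.hasSum.tendsto_sum_nat
  rw [h.2] at h2
  simpa [s_div_γ_eq_coeff, coeff_mk_one_mul, Function.comp_def] using h2.comp (tendsto_add_atTop_nat 1)

theorem tendsto_γ_div : Tendsto (fun n : ℕ => (γ F n : ℝ) / (Fintype.card F : ℝ) ^ (n ^ 2)) atTop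
    (𝓝 (aSum (Fintype.card F) (1 : ℝ))) := by
  simp only [γ_div_eq_prod]
  exact (hasProd_aSum Fintype.one_lt_card (1 : ℝ)).tendsto_prod_nat

theorem tendsto_s_div : Tendsto (fun n : ℕ => (s F n : ℝ) / (Fintype.card F : ℝ) ^ (n ^ 2)) atTop
    (𝓝 (aSum (Fintype.card F) (1 : ℝ) ^ Fintype.card F)) := by
  have h := (tendsto_s_div_γ F).mul (tendsto_γ_div F)
  rw [← pow_succ, Nat.sub_add_cancel Fintype.card_pos] at h
  refine h.congr fun n => div_mul_div_cancel₀ ?_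
  exact_mod_cast (γ_pos F n).ne'

end Evaluation

/-! ### The limit for large `q` -/

section LargeField

open PowerSeries (C X coeff mk derivative)

theorem tendsto_inv_pow_sub_one (j : ℕ) :
    Tendsto (fun q : ℕ => ((q : ℝ) ^ (j + 1) - 1)⁻¹) atTop (𝓝 0) := by
  refine tendsto_inv_atTop_zero.comp (tendsto_atTop_add_const_right _ _ ?_)
  exact (tendsto_pow_atTop (Nat.succ_ne_zero j)).comp tendsto_natCast_atTop_atTop

theorem tendsto_a_succ (j : ℕ) : Tendsto (fun q : ℕ => a q (j + 1)) atTop (𝓝 0) := by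
  induction j with
  | zero => simpa [a_succ, a_zero, div_eq_mul_inv] using (tendsto_inv_pow_sub_one 0).neg
  | succ j ih =>
    simpa [a_succ _ (j + 1), div_eq_mul_inv] using ih.neg.mul (tendsto_inv_pow_sub_one (j + 1))

/-- Here `(q - 1) a_1 = -1` exactly for `q ≥ 2`; each further index contributes a factor tending to
`0`. -/
theorem tendsto_mul_a_succ (j : ℕ) :
    Tendsto (fun q : ℕ => ((q - 1 : ℕ) : ℝ) * a q (j + 1)) atTop
      (𝓝 (if j = 0 then -1 else 0)) := by
  induction j with
  | zero =>
    refine tendsto_const_nhds.congr' ?_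
    filter_upwards [eventually_ge_atTop 2] with q hq
    have hq' : (2 : ℝ) ≤ q := by exact_mod_cast hq
    have : (q : ℝ) - 1 ≠ 0 := by linarith
    rw [a_succ, a_zero, Nat.cast_sub (by omega)]
    simp only [if_true, zero_add, pow_one, Nat.cast_one]
    field_simp
  | succ j ih =>
    have := ih.neg.mul (tendsto_inv_pow_sub_one (j + 1))
    rw [mul_zero] at this
    simp only [Nat.succ_ne_zero, if_false]
    refine this.congr fun q => ?_
    rw [a_succ _ (j + 1)]
    ring

/-- Coefficients of `G P' = m G' P` with `P = G^m`. The exponent enters the recursion explicitly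
only through the products `m * coeff (i + 1) G`, whose limits are known for `m = q - 1`. -/
theorem succ_mul_coeff_pow {G : PowerSeries ℝ} (hG : coeff 0 G = 1) (m j : ℕ) :
    (j + 1 : ℝ) * coeff (j + 1) (G ^ m) =
      (∑ p ∈ Finset.HasAntidiagonal.antidiagonal j,
        (p.1 + 1 : ℝ) * (m * coeff (p.1 + 1) G) * coeff p.2 (G ^ m)) -
      ∑ p ∈ Finset.HasAntidiagonal.antidiagonal j,
        coeff (p.1 + 1) G * (p.2 * coeff p.2 (G ^ m)) := by
  have h1 : G * derivative ℝ (G ^ m) = C (m : ℝ) * derivative ℝ G * G ^ m := by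
    rw [Derivation.leibniz_pow]
    cases m with
    | zero => simp
    | succ m => simp [pow_succ]; ring
  set P := G ^ m
  have h2 : G = 1 + mk (fun i => coeff (i + 1) G) * X := by
    ext n
    cases n with
    | zero => simpa using hG
    | succ n => simp [PowerSeries.coeff_one, PowerSeries.coeff_succ_mul_X]
  have h3 : derivative ℝ P = C (m : ℝ) * derivative ℝ G * P -
      mk (fun i => coeff (i + 1) G) * (X * derivative ℝ P) := by
    linear_combination h1 - derivative ℝ P * h2
  have h4 := congrArg (coeff j) h3
  rw [map_sub, PowerSeries.coeff_mul, PowerSeries.coeff_mul, PowerSeries.coeff_derivative] at h4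
  rw [mul_comm, h4]
  congr 1
  · refine Finset.sum_congr rfl fun p _ => ?_
    rw [PowerSeries.coeff_C_mul, PowerSeries.coeff_derivative]
    ring
  · refine Finset.sum_congr rfl fun p _ => ?_
    rw [PowerSeries.coeff_mk]
    congr 1
    cases p.2 with
    | zero => simp
    | succ n =>
      rw [PowerSeries.coeff_succ_X_mul, PowerSeries.coeff_derivative]
      push_cast
      ring

theorem tendsto_coeff_aSeries_pow (j : ℕ) :
    Tendsto (fun q : ℕ => coeff j (aSeries q ^ (q - 1))) atTop
      (𝓝 ((-1 : ℝ) ^ j / (j.factorial : ℝ))) := by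
  induction j using Nat.strong_induction_on with
  | _ j ih =>
  cases j with
  | zero => simp [aSeries, a_zero]
  | succ j =>
    -- In the limit only the term `p.1 = 0` survives, leaving `(j + 1) c_{j+1} = -c_j`, the
    -- recursion of `exp(-u)`.
    have h1 : Tendsto (fun q : ℕ => (j + 1 : ℝ) * coeff (j + 1) (aSeries q ^ (q - 1))) atTop
        (𝓝 ((∑ p ∈ Finset.HasAntidiagonal.antidiagonal j, (p.1 + 1 : ℝ) *
            (if p.1 = 0 then -1 else 0) * ((-1 : ℝ) ^ p.2 / (p.2.factorial : ℝ))) -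
          ∑ p ∈ Finset.HasAntidiagonal.antidiagonal j,
            0 * (p.2 * ((-1 : ℝ) ^ p.2 / (p.2.factorial : ℝ))))) := by
      have hle : ∀ p ∈ Finset.HasAntidiagonal.antidiagonal j, p.2 < j + 1 := fun p hp => by
        have := Finset.HasAntidiagonal.mem_antidiagonal.1 hp
        omega
      have h0 : ∀ q, coeff 0 (aSeries q) = 1 := fun q => by
        simp only [aSeries, PowerSeries.coeff_mk, a_zero]
      simp only [succ_mul_coeff_pow (h0 _) _ j]
      refine Tendsto.sub (tendsto_finsetSum _ fun p hp => ?_) (tendsto_finsetSum _ fun p hp => ?_)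
      · refine Tendsto.mul (Tendsto.const_mul _ ?_) (ih _ (hle p hp))
        simpa [aSeries] using tendsto_mul_a_succ p.1
      · refine Tendsto.mul ?_ (Tendsto.const_mul _ (ih _ (hle p hp)))
        simpa [aSeries] using tendsto_a_succ p.1
    have h2 := h1.const_mul ((j + 1 : ℝ)⁻¹)
    have hj : (j + 1 : ℝ) ≠ 0 := by positivity
    simp only [inv_mul_cancel_left₀ hj] at h2
    convert h2 using 2
    rw [Finset.Nat.sum_antidiagonal_eq_sum_range_succ_mk, Finset.sum_range_succ']
    simp only [zero_mul, Finset.sum_const_zero, Nat.factorial_succ, pow_succ]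
    push_cast
    simp
    field_simp

theorem tendsto_prod_one_sub (n : ℕ) :
    Tendsto (fun q : ℕ => ∏ j ∈ Finset.range n, (1 - 1 / (q : ℝ) ^ (j + 1))) atTop (𝓝 1) := by
  have h : Tendsto (fun q : ℕ => ∏ j ∈ Finset.range n, (1 - 1 / (q : ℝ) ^ (j + 1))) atTop
      (𝓝 (∏ _j ∈ Finset.range n, (1 - 0))) := by
    refine tendsto_finsetProd _ fun j _ => tendsto_const_nhds.sub ?_
    refine tendsto_const_nhds.div_atTop ?_
    exact (tendsto_pow_atTop (Nat.succ_ne_zero j)).comp tendsto_natCast_atTop_atTop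
  simpa using h

theorem s_div_eq (F : Type*) [Field F] [Fintype F] (n : ℕ) :
    (s F n : ℝ) / (Fintype.card F : ℝ) ^ (n ^ 2) =
      (∏ j ∈ Finset.range n, (1 - 1 / (Fintype.card F : ℝ) ^ (j + 1))) *
        ∑ j ∈ Finset.range (n + 1), coeff j (aSeries (Fintype.card F) ^ (Fintype.card F - 1)) := by
  rw [← coeff_mk_one_mul, ← s_div_γ_eq_coeff, ← γ_div_eq_prod, mul_comm]
  exact (div_mul_div_cancel₀ (by exact_mod_cast (γ_pos F n).ne')).symm

end LargeField

end SpecFree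

/-! ### Assembly of the main theorem -/

theorem mainTheorem5 :
    (∀ (F : Type u) [Field F] [Fintype F] (q : ℕ), Fintype.card F = q →
      -- the order of the general linear group
      (∀ n : ℕ, (SpecFree.γ F n : ℝ) = ∏ j ∈ Finset.range n, ((q : ℝ) ^ n - (q : ℝ) ^ j)) ∧
      -- the generating function, as an identity of formal power series in `X`
      (Multipliable (fun r : ℕ =>
          ((1 - PowerSeries.C (1 / (q : ℝ) ^ (r + 1)) * PowerSeries.X) ^ (q - 1) :
            PowerSeries ℝ)) ∧
        (1 + PowerSeries.mk
            (fun n : ℕ => if n = 0 then (0 : ℝ) else (SpecFree.s F n : ℝ) / SpecFree.γ F n) :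
          PowerSeries ℝ) =
        (1 - PowerSeries.X)⁻¹ *
          ∏' r : ℕ, (1 - PowerSeries.C (1 / (q : ℝ) ^ (r + 1)) * PowerSeries.X) ^ (q - 1)) ∧
      -- the generating function, as an identity of convergent series for `|u| < 1`
      (∀ u : ℂ, ‖u‖ < 1 →
        Summable (fun n : ℕ =>
          (SpecFree.s F (n + 1) : ℂ) / (SpecFree.γ F (n + 1) : ℂ) * u ^ (n + 1)) ∧
        Multipliable (fun r : ℕ => (1 - u / (q : ℂ) ^ (r + 1)) ^ (q - 1)) ∧
        1 + ∑' n : ℕ, (SpecFree.s F (n + 1) : ℂ) / (SpecFree.γ F (n + 1) : ℂ) * u ^ (n + 1) =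
          1 / (1 - u) * ∏' r : ℕ, (1 - u / (q : ℂ) ^ (r + 1)) ^ (q - 1)) ∧
      -- the explicit formula
      (∀ n : ℕ, (SpecFree.s F n : ℝ) = (SpecFree.γ F n : ℝ) *
        ∑ j ∈ Finset.range (n + 1), ∑ i ∈ Finset.Nat.antidiagonalTuple (q - 1) j,
          ∏ k : Fin (q - 1), SpecFree.a q (i k)) ∧
      -- the limits for `n → ∞`
      Multipliable (fun r : ℕ => (1 - 1 / (q : ℝ) ^ (r + 1)) ^ q) ∧
      Tendsto (fun n : ℕ => (SpecFree.s F n : ℝ) / (q : ℝ) ^ (n ^ 2)) atTop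
        (𝓝 (∏' r : ℕ, (1 - 1 / (q : ℝ) ^ (r + 1)) ^ q)) ∧
      Tendsto (fun n : ℕ => ((SpecFree.γ F n : ℝ) / (q : ℝ) ^ (n ^ 2)) ^ q) atTop
        (𝓝 (∏' r : ℕ, (1 - 1 / (q : ℝ) ^ (r + 1)) ^ q))) ∧
    -- the limit for `q → ∞`, with `q` running through the orders of finite fields
    (∀ n : ℕ, ∀ ε : ℝ, 0 < ε → ∃ Q : ℕ, ∀ (F : Type u) [Field F] [Fintype F] (q : ℕ),
      Fintype.card F = q → Q ≤ q →
        |(SpecFree.s F n : ℝ) / (q : ℝ) ^ (n ^ 2) -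
          ∑ j ∈ Finset.range (n + 1), (-1 : ℝ) ^ j / (j.factorial : ℝ)| < ε) := by
  refine ⟨?_, ?_⟩
  · rintro F _ _ q rfl
    have hq : 2 ≤ Fintype.card F := Fintype.one_lt_card
    have hps := SpecFree.hasProd_pow (SpecFree.hasProd_aSeries hq) (Fintype.card F - 1)
    have hr := SpecFree.hasProd_pow (SpecFree.hasProd_aSum hq (1 : ℝ)) (Fintype.card F)
    refine ⟨SpecFree.γ_eq_prod F, ⟨hps.multipliable, ?_⟩, ?_, SpecFree.s_eq_mul_sum F,
      hr.multipliable, ?_, ?_⟩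
    · have h1 : (1 - PowerSeries.X : PowerSeries ℝ)⁻¹ = PowerSeries.mk 1 := by
        rw [PowerSeries.inv_eq_iff_mul_eq_one (by simp)]
        exact SpecFree.mk_one_mul_one_sub_X
      rw [hps.tprod_eq, h1]
      ext n
      rw [← SpecFree.s_div_γ_eq_coeff, map_add, PowerSeries.coeff_one, PowerSeries.coeff_mk]
      split_ifs with hn
      · subst hn
        rw [SpecFree.s_div_γ_eq_coeff, SpecFree.coeff_mk_one_mul]
        simp [SpecFree.aSeries, SpecFree.a_zero]
      · simp
    · intro u hu
      have hc := SpecFree.hasProd_pow (SpecFree.hasProd_aSum hq u) (Fintype.card F - 1)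
      obtain ⟨h1, h2⟩ := (SpecFree.evalsTo_mk_one hu).mul
        ((SpecFree.evalsTo_aSeries hq u).pow (Fintype.card F - 1))
      simp only [← SpecFree.s_div_γ_eq_coeff] at h1 h2
      have h3 : (SpecFree.s F 0 : ℝ) / SpecFree.γ F 0 = 1 := by
        rw [SpecFree.s_div_γ_eq_coeff, SpecFree.coeff_mk_one_mul]
        simp [SpecFree.aSeries, SpecFree.a_zero]
      rw [h1.of_norm.tsum_eq_zero_add, h3] at h2
      have h4 := (summable_nat_add_iff 1).2 h1.of_norm
      simp at h2 h4
      refine ⟨h4, hc.multipliable, ?_⟩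
      rw [hc.tprod_eq, h2, one_div]
    · rw [hr.tprod_eq]
      exact SpecFree.tendsto_s_div F
    · rw [hr.tprod_eq]
      exact (SpecFree.tendsto_γ_div F).pow _
  · intro n ε hε
    -- The formula for `s_n/q^(n²)` makes sense for every natural `q`, so the limit is taken over
    -- all of `ℕ` and then specialised to field orders.
    have h := (SpecFree.tendsto_prod_one_sub n).mul
      (tendsto_finsetSum (Finset.range (n + 1)) fun j _ => SpecFree.tendsto_coeff_aSeries_pow j)
    rw [one_mul] at h
    obtain ⟨Q, hQ⟩ := Metric.tendsto_atTop.1 h ε hε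
    refine ⟨Q, ?_⟩
    rintro F _ _ q rfl hq
    rw [SpecFree.s_div_eq, ← Real.dist_eq]
    exact hQ _ hq
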